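/- For real numbers $a_1,a_2,a_3$ put $s_1=a_1+a_2+a_3$, $s_2=a_1a_2+a_1a_3+a_2a_3$, $s_3=a_1a_2a_3$ and $$\begin{aligned} Q(a_1,a_2,a_3)={}&(2s_1+4s_3-1)\bigl(64s_1^5-64s_1^4+8s_1^3+12s_1^2-6s_1+1\\ &\qquad+240s_3s_1^2-240s_3s_1-1536s_3^2s_1-4096s_3^3+60s_3+768s_3^2\bigr)\\ &-8s_1(2s_1+4s_3-1)(2s_1-32s_3-1)(10s_1+32s_3-5)s_2\\ &-16s_1^2(13-52s_1+640s_3s_1+1024s_3^2-320s_3+52s_1^2)s_2^2\\ &+64(2s_1-1)(2s_1-32s_3-1)s_2^3+2048s_1(2s_1-1)s_2^4 . \end{aligned}$$ Let $\Omega=\{(a_1,a_2,a_3)\in\mathbb{R}^3 : Q(a_1,a_2,a_3)=0\}$, and let $O_3$ be the connected component of $(0,1/2)^3\setminus\Omega$ that contains the point $(1/6,1/4,1/3)$. Let $k\ge l\ge m\ge 1$ be integers with $l\ge 2$, and let $$(a_1,a_2,a_3)=\left(\frac{k}{2(k+l+m-2)},\ \frac{l}{2(k+l+m-2)},\ \frac{m}{2(k+l+m-2)}\right)$$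 be the point associated with the generalized Wallach space $SO(k+l+m)/SO(k)\times SO(l)\times SO(m)$. If $$m<\bigl(1+\sqrt{k+l}\bigr)\frac{k+l-2}{k+l-1},$$ then $(a_1,a_2,a_3)\in O_3$. In particular, $(a_1,a_2,a_3)\in O_3$ in each of the following cases: 1. $m<\sqrt{k+l}$; 2. $m=1$; 3. $m=2$ and $k+l\ge 5$; 4. $m=3$ and $k+l\ge 7$. -/

import Mathlib

/-- The polynomial `Q(a₁, a₂, a₃)`, written through the elementary symmetric functions
`s₁`, `s₂`, `s₃` of its arguments. -/
def wallachQ (a₁ a₂ a₃ : ℝ) : ℝ :=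
  let s₁ : ℝ := a₁ + a₂ + a₃
  let s₂ : ℝ := a₁ * a₂ + a₁ * a₃ + a₂ * a₃
  let s₃ : ℝ := a₁ * a₂ * a₃
  (2 * s₁ + 4 * s₃ - 1) *
      (64 * s₁ ^ 5 - 64 * s₁ ^ 4 + 8 * s₁ ^ 3 + 12 * s₁ ^ 2 - 6 * s₁ + 1
        + 240 * s₃ * s₁ ^ 2 - 240 * s₃ * s₁ - 1536 * s₃ ^ 2 * s₁
        - 4096 * s₃ ^ 3 + 60 * s₃ + 768 * s₃ ^ 2)
    - 8 * s₁ * (2 * s₁ + 4 * s₃ - 1) * (2 * s₁ - 32 * s₃ - 1) * (10 * s₁ + 32 * s₃ - 5) * s₂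
    - 16 * s₁ ^ 2 *
      (13 - 52 * s₁ + 640 * s₃ * s₁ + 1024 * s₃ ^ 2 - 320 * s₃ + 52 * s₁ ^ 2) * s₂ ^ 2
    + 64 * (2 * s₁ - 1) * (2 * s₁ - 32 * s₃ - 1) * s₂ ^ 3
    + 2048 * s₁ * (2 * s₁ - 1) * s₂ ^ 4

/-- The algebraic surface `Ω = {Q = 0}` in `ℝ³`. -/
def wallachOmega : Set (Fin 3 → ℝ) :=
  {a | wallachQ (a 0) (a 1) (a 2) = 0}

/-- The open cube `(0, 1/2)³`. -/
def openHalfCube : Set (Fin 3 → ℝ) :=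
  {a | ∀ i, 0 < a i ∧ a i < 1 / 2}

/-- The set `O₃`: the connected component of `(0, 1/2)³ \ Ω` containing `(1/6, 1/4, 1/3)`. -/
def wallachO3 : Set (Fin 3 → ℝ) :=
  connectedComponentIn (openHalfCube \ wallachOmega) ![1 / 6, 1 / 4, 1 / 3]

/-- The point `(a₁, a₂, a₃)` of the space `SO(k+l+m)/SO(k)×SO(l)×SO(m)`. -/
noncomputable def soPoint (k l m : ℕ) : Fin 3 → ℝ :=
  ![(k : ℝ) / (2 * ((k : ℝ) + l + m - 2)),
    (l : ℝ) / (2 * ((k : ℝ) + l + m - 2)),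
    (m : ℝ) / (2 * ((k : ℝ) + l + m - 2))]

/-! Write A = k+m, B = l+m, a = k-m, b = l-m, M = k+l+m-2 and K = 4M² - 2mAB. After clearing
denominators, Q is minus the discriminant of a binary cubic in these quantities, so Q > 0 as soon as
the form `cubicHessian` is positive at one vector.

The hypothesis on m amounts to m²(k+l) < M², that is, K > -2mab. For K ≤ 2Bab the vector (B, -A)
serves (`cubicHessian_second_pos`); for K > 2Bab the vector (1, 0) does (`cubicHessian_first_pos`),
thanks to K < 3A²a (`coeff_upper_bound`).

Hence Q has no zero on the connected region `wallachParams` of real parameters. Since Q is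
symmetric, permuting coordinates gives further connected sets avoiding Ω. These are chained together
at points with two equal coordinates, and one of them contains (1/6, 1/4, 1/3). -/

/-! ### Binary cubics and Q as a discriminant -/

/-- The negative of the discriminant of the binary cubic `a x³ + b x² y + c x y² + d y³`. -/
def cubicNegDisc (a b c d : ℝ) : ℝ :=
  27 * a ^ 2 * d ^ 2 - 18 * a * b * c * d + 4 * a * c ^ 3 + 4 * b ^ 3 * d - b ^ 2 * c ^ 2

/-- The negative of the Hessian covariant of the binary cubic `a x³ + b x² y + c x y² + d y³`,
up to a positive constant. -/
def cubicHessian (a b c d x y : ℝ) : ℝ :=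
  (3 * a * c - b ^ 2) * x ^ 2 + (9 * a * d - b * c) * x * y + (3 * b * d - c ^ 2) * y ^ 2

/-- A binary cubic whose Hessian covariant takes a positive value has only one real root. The proof
is the classical syzygy between the covariants of a binary cubic. -/
theorem cubicNegDisc_pos_of_cubicHessian_pos {a b c d x y : ℝ}
    (h : 0 < cubicHessian a b c d x y) : 0 < cubicNegDisc a b c d := by
  have syzygy : 27 * (a * x ^ 3 + b * x ^ 2 * y + c * x * y ^ 2 + d * y ^ 3) ^ 2
        * cubicNegDisc a b c d
      = 4 * cubicHessian a b c d x y ^ 3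
        + ((3 * a * x ^ 2 + 2 * b * x * y + c * y ^ 2)
            * ((9 * a * d - b * c) * x + 2 * (3 * b * d - c ^ 2) * y)
          - (b * x ^ 2 + 2 * c * x * y + 3 * d * y ^ 2)
            * (2 * (3 * a * c - b ^ 2) * x + (9 * a * d - b * c) * y)) ^ 2 := by
    unfold cubicNegDisc cubicHessian
    ring
  by_contra! hn
  have h3 : 0 < cubicHessian a b c d x y ^ 3 := by positivity
  have := mul_nonpos_of_nonneg_of_nonpos
    (by positivity :
      0 ≤ 27 * (a * x ^ 3 + b * x ^ 2 * y + c * x * y ^ 2 + d * y ^ 3) ^ 2) hn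
  rw [syzygy] at this
  nlinarith [sq_nonneg ((3 * a * x ^ 2 + 2 * b * x * y + c * y ^ 2)
            * ((9 * a * d - b * c) * x + 2 * (3 * b * d - c ^ 2) * y)
          - (b * x ^ 2 + 2 * c * x * y + 3 * d * y ^ 2)
            * (2 * (3 * a * c - b ^ 2) * x + (9 * a * d - b * c) * y))]

/-- Up to a positive factor, `wallachQ` is the negative discriminant of a binary cubic: the
determinant of the pencil of conics cutting out the invariant Einstein metrics. -/
theorem wallachQ_eq_cubicNegDisc {k l m M : ℝ} (hM : M ≠ 0) (hk : k = M + 2 - l - m) :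
    16 * M ^ 12 * wallachQ (k / (2 * M)) (l / (2 * M)) (m / (2 * M)) =
      cubicNegDisc ((k + m) ^ 2 * (k - m))
        (-(4 * M ^ 2 - 2 * m * (k + m) * (l + m) - (k + m) * ((k - m) * (l - m))))
        (4 * M ^ 2 - 2 * m * (k + m) * (l + m) - (l + m) * ((k - m) * (l - m)))
        (-((l + m) ^ 2 * (l - m))) := by
  have h1 : k / (2 * M) + l / (2 * M) + m / (2 * M) = (M + 2) / (2 * M) := by
    rw [hk]; field_simp; ring
  have h2 : k / (2 * M) * (l / (2 * M)) + k / (2 * M) * (m / (2 * M))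
      + l / (2 * M) * (m / (2 * M)) = (k * l + k * m + l * m) / (4 * M ^ 2) := by
    field_simp; ring
  have h3 : k / (2 * M) * (l / (2 * M)) * (m / (2 * M)) = k * l * m / (8 * M ^ 3) := by
    field_simp; ring
  -- Denominators are cleared with s₁ = (M+2)/(2M) while e = kl+km+lm and f = klm are still free
  -- variables, which keeps the polynomials small.
  have h4 : ∀ e f : ℝ, 16 * M ^ 12 *
      ((2 * ((M + 2) / (2 * M)) + 4 * (f / (8 * M ^ 3)) - 1) *
      (64 * ((M + 2) / (2 * M)) ^ 5 - 64 * ((M + 2) / (2 * M)) ^ 4 + 8 * ((M + 2) / (2 * M)) ^ 3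
        + 12 * ((M + 2) / (2 * M)) ^ 2 - 6 * ((M + 2) / (2 * M)) + 1
        + 240 * (f / (8 * M ^ 3)) * ((M + 2) / (2 * M)) ^ 2
        - 240 * (f / (8 * M ^ 3)) * ((M + 2) / (2 * M))
        - 1536 * (f / (8 * M ^ 3)) ^ 2 * ((M + 2) / (2 * M))
        - 4096 * (f / (8 * M ^ 3)) ^ 3 + 60 * (f / (8 * M ^ 3)) + 768 * (f / (8 * M ^ 3)) ^ 2)
    - 8 * ((M + 2) / (2 * M)) * (2 * ((M + 2) / (2 * M)) + 4 * (f / (8 * M ^ 3)) - 1)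
      * (2 * ((M + 2) / (2 * M)) - 32 * (f / (8 * M ^ 3)) - 1)
      * (10 * ((M + 2) / (2 * M)) + 32 * (f / (8 * M ^ 3)) - 5) * (e / (4 * M ^ 2))
    - 16 * ((M + 2) / (2 * M)) ^ 2 *
      (13 - 52 * ((M + 2) / (2 * M)) + 640 * (f / (8 * M ^ 3)) * ((M + 2) / (2 * M))
        + 1024 * (f / (8 * M ^ 3)) ^ 2 - 320 * (f / (8 * M ^ 3))
        + 52 * ((M + 2) / (2 * M)) ^ 2) * (e / (4 * M ^ 2)) ^ 2
    + 64 * (2 * ((M + 2) / (2 * M)) - 1) * (2 * ((M + 2) / (2 * M)) - 32 * (f / (8 * M ^ 3)) - 1)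
      * (e / (4 * M ^ 2)) ^ 3
    + 2048 * ((M + 2) / (2 * M)) * (2 * ((M + 2) / (2 * M)) - 1) * (e / (4 * M ^ 2)) ^ 4)
    = 16 * ((4 * M ^ 2 + f) * (4 * M ^ 4 * (M + 1) * (M ^ 2 + 4 * M + 8) + 15 * f * M ^ 4
        - 12 * f ^ 2 * M ^ 2 - 4 * f ^ 3)
      - 2 * (M + 2) * (4 * M ^ 2 + f) * (M ^ 2 - 2 * f) * (5 * M ^ 2 + 2 * f) * e
      - (M + 2) ^ 2 * (13 * M ^ 4 + 20 * f * M ^ 2 + 4 * f ^ 2) * e ^ 2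
      + 4 * M ^ 2 * (M ^ 2 - 2 * f) * e ^ 3 + 8 * M ^ 2 * (M + 2) * e ^ 4) := by
    intro e f
    field_simp
    ring
  unfold wallachQ
  simp only [h1, h2, h3]
  rw [h4, hk]
  unfold cubicNegDisc
  ring

/-! ### Positivity of Q on the real parameter region -/

/-- Parameters `(k, l, m)` satisfying the sufficient condition, without integrality. -/
def wallachParams : Set (ℝ × ℝ × ℝ) :=
  {x | 2 ≤ x.2.1 ∧ x.2.1 ≤ x.1 ∧ 1 ≤ x.2.2 ∧ x.2.2 ≤ x.2.1 ∧
    x.2.2 ^ 2 * (x.1 + x.2.1) < (x.1 + x.2.1 + x.2.2 - 2) ^ 2}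

/-- Since (k+m)(l+m) - (k-m)(l-m) = 2m(k+l), this is the hypothesis multiplied by 4. -/
theorem coeff_lower_bound {k l m M : ℝ} (h : m ^ 2 * (k + l) < M ^ 2) :
    -(2 * m * ((k - m) * (l - m))) < 4 * M ^ 2 - 2 * m * (k + m) * (l + m) := by
  linear_combination 4 * h

theorem coeff_upper_bound {k l m : ℝ} (hl : 2 ≤ l) (hlk : l ≤ k) (hm : 1 ≤ m) (hml : m ≤ l)
    (h : m ^ 2 * (k + l) < (k + l + m - 2) ^ 2) :
    4 * (k + l + m - 2) ^ 2 - 2 * m * (k + m) * (l + m) < 3 * ((k + m) ^ 2 * (k - m)) := by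
  -- the difference is a concave function `D` of `l`, so it suffices to treat the extreme values
  obtain ⟨D, hD⟩ : ∃ D : ℝ → ℝ, D = fun l =>
      3 * ((k + m) ^ 2 * (k - m)) - (4 * (k + l + m - 2) ^ 2 - 2 * m * (k + m) * (l + m)) :=
    ⟨_, rfl⟩
  suffices H : 0 < D l by simp only [hD] at H; linarith
  have concave : ∀ j, (k - j) * D l =
      (k - l) * D j + (l - j) * D k + 4 * (k - l) * (l - j) * (k - j) := by
    intro j; simp only [hD]; ring
  have main : ∀ j, j < k → j ≤ l → 0 < D j → 0 < D k → 0 < D l := by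
    intro j hjk hjl hj hk
    refine pos_of_mul_pos_right (a := k - j) ?_ (by linarith)
    have e1 : 0 ≤ 4 * (k - l) * (l - j) * (k - j) :=
      mul_nonneg (mul_nonneg (by linarith) (by linarith)) (by linarith)
    have e2 : 0 ≤ (k - l) * D j := mul_nonneg (by linarith) hj.le
    have e3 : 0 ≤ (l - j) * D k := mul_nonneg (by linarith) hk.le
    rw [concave]
    rcases hlk.lt_or_eq with hlt | rfl
    · have : 0 < (k - l) * D j := mul_pos (by linarith) hj
      linarith
    · have : 0 < (l - j) * D l := mul_pos (by linarith) hk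
      linarith
  -- The least admissible l is max(m, 2). For m ≥ 2, `e0` is the value of `D` at k = l = m; its
  -- nonnegativity contradicts `h` there, so k = m cannot occur.
  rcases le_or_gt 2 m with h2 | h2
  · have e0 : 0 ≤ 4 * ((m - 2) ^ 2 * (2 * m - 1)) := by
      have : 0 ≤ 2 * m - 1 := by linarith
      positivity
    rcases (hml.trans hlk).lt_or_eq with hmk | rfl
    · obtain ⟨s, rfl⟩ : ∃ s, k = m + s := ⟨k - m, by ring⟩
      have hs : 0 < s := by linarith
      have e3 : 0 < 3 * s ^ 3 := by positivity
      refine main m hmk hml ?_ ?_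
      · have e1 : 0 < (16 * m ^ 2 - 24 * m + 16) * s := mul_pos (by nlinarith) hs
        have e2 : 0 < (12 * m - 4) * s ^ 2 := mul_pos (by linarith) (by positivity)
        simp only [hD]
        linear_combination e0 + e1 + e2 + e3
      · have e1 : 0 < (20 * m ^ 2 - 48 * m + 32) * s := mul_pos (by nlinarith) hs
        have e2 : 0 < (14 * m - 16) * s ^ 2 := mul_pos (by linarith) (by positivity)
        simp only [hD]
        linear_combination e0 + e1 + e2 + e3
    · obtain rfl : l = m := le_antisymm hlk hml
      linarith
  · obtain ⟨s, rfl⟩ : ∃ s, k = 2 + s := ⟨k - 2, by ring⟩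
    have hs : 0 ≤ s := by linarith
    have hk : 0 < D (2 + s) := by
      have e0 : 0 < (m + 2) ^ 2 * (2 - m) := mul_pos (by positivity) (by linarith)
      have e1 : 0 ≤ (m + 2) ^ 2 * s := by positivity
      have e2 : 0 ≤ (5 * m + 2) * s ^ 2 := by positivity
      have e3 : 0 ≤ 3 * s ^ 3 := by positivity
      simp only [hD]
      linear_combination e0 + e1 + e2 + e3
    rcases hs.lt_or_eq with hs | rfl
    · refine main 2 (by linarith) hl ?_ hk
      have : 0 < (2 + s + m) * (4 + 8 * s + 3 * s ^ 2 - m ^ 2) :=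
        mul_pos (by linarith) (by nlinarith)
      simp only [hD]
      linear_combination this
    · obtain rfl : l = 2 + 0 := le_antisymm hlk (by linarith)
      exact hk

theorem cubicHessian_first_pos {A B a b K : ℝ} (hB : 0 < B) (hBA : B ≤ A) (hb : 0 ≤ b)
    (hba : b ≤ a) (hbB : b ≤ B) (h1 : 2 * B * (a * b) < K)
    (h2 : K < 3 * (A ^ 2 * a)) :
    0 < cubicHessian (A ^ 2 * a) (-(K - A * (a * b))) (K - B * (a * b)) (-(B ^ 2 * b)) 1 0 := by
  have ha : 0 ≤ a := hb.trans hba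
  have hq : 0 ≤ a * b := mul_nonneg ha hb
  -- concavity in `K` on the interval from `2 B a b` to `3 A² a`
  refine pos_of_mul_pos_right (a := 3 * (A ^ 2 * a) - 2 * B * (a * b)) ?_ (by linarith)
  -- `e1` and `e2` are the weighted values at K = 2Bab and K = 3A²a; `e3` is the strictly positive
  -- concavity term.
  have e1 : 0 ≤ (3 * (A ^ 2 * a) - K) * (a * b * a * (3 * A ^ 2 * B - b * (2 * B - A) ^ 2)) := by
    have : (2 * B - A) ^ 2 ≤ A ^ 2 := by nlinarith
    have : b * (2 * B - A) ^ 2 ≤ B * A ^ 2 := by gcongr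
    have : 0 ≤ B * A ^ 2 := by positivity
    exact mul_nonneg (by linarith) (mul_nonneg (by positivity) (by linarith))
  have e2 : 0 ≤ (K - 2 * B * (a * b)) * (A ^ 2 * (a * b) * a * (6 * A - 3 * B - b)) :=
    mul_nonneg (by linarith) (mul_nonneg (by positivity) (by linarith))
  have e3 : 0 < (K - 2 * B * (a * b)) * (3 * (A ^ 2 * a) - K)
      * (3 * (A ^ 2 * a) - 2 * B * (a * b)) :=
    mul_pos (mul_pos (by linarith) (by linarith)) (by linarith)
  unfold cubicHessian
  linear_combination e1 + e2 + e3

/-- At (B, -A) the form is a concave quadratic in K with positive constant term, so each sign of K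
needs only a bound at the far end of its range. -/
theorem cubicHessian_second_pos {k l m K : ℝ} (hlk : l ≤ k) (hm : 0 < m) (hml : m ≤ l)
    (h1 : K ≤ 2 * (l + m) * ((k - m) * (l - m)))
    (h2 : -(2 * m * ((k - m) * (l - m))) < K) :
    0 < cubicHessian ((k + m) ^ 2 * (k - m)) (-(K - (k + m) * ((k - m) * (l - m))))
      (K - (l + m) * ((k - m) * (l - m))) (-((l + m) ^ 2 * (l - m))) (l + m) (-(k + m)) := by
  obtain ⟨b, rfl⟩ : ∃ b, l = m + b := ⟨l - m, by ring⟩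
  obtain ⟨a, rfl⟩ : ∃ a, k = m + a := ⟨k - m, by ring⟩
  have hb : 0 ≤ b := by linarith
  have hba : b ≤ a := by linarith
  have ha : 0 ≤ a := hb.trans hba
  obtain ⟨A, hA⟩ : ∃ A, A = m + a + m := ⟨_, rfl⟩
  obtain ⟨B, hB⟩ : ∃ B, B = m + b + m := ⟨_, rfl⟩
  obtain ⟨W, hW⟩ : ∃ W, W = A * B * (a + b) + a * b * (A + B) := ⟨_, rfl⟩
  obtain ⟨S, hS⟩ : ∃ S, S = A ^ 2 + A * B + B ^ 2 := ⟨_, rfl⟩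
  have hA0 : 0 < A := by rw [hA]; positivity
  have hB0 : 0 < B := by rw [hB]; positivity
  have hBA : B ≤ A := by linarith
  have hS0 : 0 < S := by rw [hS]; positivity
  have hW0 : 0 ≤ W := by rw [hW]; positivity
  simp only [add_sub_cancel_left, ← hA, ← hB] at h1 h2 ⊢
  -- If ab = 0, the two bounds on K contradict each other.
  have hq : 0 < a * b := by
    refine (mul_nonneg ha hb).lt_of_ne fun h => ?_
    rw [← h] at h1 h2
    linarith
  have expand : cubicHessian (A ^ 2 * a) (-(K - A * (a * b))) (K - B * (a * b)) (-(B ^ 2 * b))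
      B (-A) = 12 * m * (A + B - m) * (a * b) * (A ^ 2 * B ^ 2) + K * (3 * A * B * W - K * S) := by
    rw [hW, hS]
    unfold cubicHessian
    rw [hA, hB]
    ring
  rw [expand]
  have hn : 0 < A + B - m := by linarith
  rcases le_or_gt 0 K with hK | hK
  · have e1 : 2 * B * (a * b) * S ≤ 3 * A * B * W := by
      have f1 : 0 ≤ a * b * A ^ 2 * B := by positivity
      have f2 : 0 ≤ a * b * A * B ^ 2 := by positivity
      have f3 : 0 ≤ b * A ^ 2 * B ^ 2 := by positivity
      have f4 : 0 ≤ 2 * a * B ^ 2 * (A ^ 2 - b * B) := by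
        refine mul_nonneg (by positivity) ?_
        nlinarith
      have f5 : 0 ≤ a * A ^ 2 * B ^ 2 := by positivity
      rw [hS, hW]
      linear_combination f1 + f2 + 3 * f3 + f4 + f5
    have e2 : K * S ≤ 2 * B * (a * b) * S := by gcongr
    have e3 : 0 ≤ K * (3 * A * B * W - K * S) := mul_nonneg hK (by linarith)
    have e4 : 0 < 12 * m * (A + B - m) * (a * b) * (A ^ 2 * B ^ 2) := by positivity
    linarith
  -- This is positivity at the extreme K = -2mab, divided by 2mab.
  · have e1 : 3 * A * B * W + 2 * m * (a * b) * S < 6 * (A + B - m) * (A ^ 2 * B ^ 2) := by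
      have haA : a ≤ A := by linarith
      have hbB : b ≤ B := by linarith
      have f1 : 2 * m * (a * b) * S ≤ 2 * m * (A * B) * S := by gcongr
      have f2 : 0 < 6 * m * (A ^ 2 * B ^ 2) := by positivity
      have f3 : 0 ≤ m * (A * B) * (A + B) * (a + b + m) := by positivity
      subst hA hB hS hW
      linear_combination f1 + 4 / 3 * f2 + 4 * f3
    have e2 : -K * (3 * A * B * W + -K * S)
        ≤ 2 * m * (a * b) * (3 * A * B * W + 2 * m * (a * b) * S) := by
      have : -K ≤ 2 * m * (a * b) := by linarith
      have : 0 ≤ -K := by linarith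
      gcongr
    have e3 : 0 < 2 * m * (a * b) := by positivity
    have e4 := mul_lt_mul_of_pos_left e1 e3
    linear_combination e2 + e4

theorem wallachQ_pos {k l m : ℝ} (h : (k, l, m) ∈ wallachParams) :
    0 < wallachQ (k / (2 * (k + l + m - 2))) (l / (2 * (k + l + m - 2)))
      (m / (2 * (k + l + m - 2))) := by
  obtain ⟨hl, hlk, hm, hml, h⟩ := h
  simp only at hl hlk hm hml h
  have hM : 0 < k + l + m - 2 := by linarith
  have key := wallachQ_eq_cubicNegDisc hM.ne' (by ring : k = (k + l + m - 2) + 2 - l - m)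
  refine pos_of_mul_pos_right (a := 16 * (k + l + m - 2) ^ 12) ?_ (by positivity)
  rw [key]
  have hlow := coeff_lower_bound (k := k) (l := l) h
  rcases le_or_gt (4 * (k + l + m - 2) ^ 2 - 2 * m * (k + m) * (l + m))
    (2 * (l + m) * ((k - m) * (l - m))) with hK | hK
  · exact cubicNegDisc_pos_of_cubicHessian_pos
      (cubicHessian_second_pos hlk (by linarith) hml hK hlow)
  · refine cubicNegDisc_pos_of_cubicHessian_pos (x := 1) (y := 0)
      (cubicHessian_first_pos (by linarith) (by linarith) (by linarith) (by linarith)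
        (by linarith) hK (coeff_upper_bound hl hlk hm hml h))

/-! ### Connectedness and passage to the component -/

/-- The point of `ℝ³` attached to real parameters `(k, l, m)`. -/
noncomputable def wallachPoint (x : ℝ × ℝ × ℝ) : Fin 3 → ℝ :=
  ![x.1 / (2 * (x.1 + x.2.1 + x.2.2 - 2)), x.2.1 / (2 * (x.1 + x.2.1 + x.2.2 - 2)),
    x.2.2 / (2 * (x.1 + x.2.1 + x.2.2 - 2))]

theorem continuousOn_wallachPoint : ContinuousOn wallachPoint wallachParams := by
  have hne : ∀ x ∈ wallachParams, 2 * (x.1 + x.2.1 + x.2.2 - 2) ≠ 0 := by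
    rintro x ⟨h1, h2, h3, -, -⟩
    have : 0 < x.1 + x.2.1 + x.2.2 - 2 := by linarith
    positivity
  refine continuousOn_pi.2 fun i => ?_
  fin_cases i <;> simp only [wallachPoint] <;> refine ContinuousOn.div ?_ ?_ hne <;> fun_prop

theorem wallachPoint_mem {x : ℝ × ℝ × ℝ} (h : x ∈ wallachParams) :
    wallachPoint x ∈ openHalfCube \ wallachOmega := by
  refine ⟨?_, fun h0 => (wallachQ_pos (k := x.1) (l := x.2.1) (m := x.2.2) h).ne' h0⟩
  obtain ⟨h1, h2, h3, h4, -⟩ := h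
  have hM : 0 < x.1 + x.2.1 + x.2.2 - 2 := by linarith
  intro i
  fin_cases i <;> simp only [wallachPoint] <;>
    refine ⟨div_pos ?_ (by positivity), (div_lt_iff₀ (by positivity)).2 ?_⟩ <;>
    linarith

theorem isPreconnected_wallachParams : IsPreconnected wallachParams := by
  -- every point can be joined to the slice `m = 1` by decreasing `m`
  have hslice : Convex ℝ {p : ℝ × ℝ | 2 ≤ p.2 ∧ p.2 ≤ p.1} := by
    rintro ⟨k, l⟩ ⟨h1, h2⟩ ⟨k', l'⟩ ⟨h1', h2'⟩ s t hs ht hst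
    simp only at h1 h2 h1' h2'
    refine ⟨?_, ?_⟩ <;> simp only [Prod.smul_mk, Prod.mk_add_mk, smul_eq_mul] <;> nlinarith
  refine isPreconnected_of_forall (2, 2, 1) ?_
  rintro ⟨k, l, m⟩ ⟨h1, h2, h3, h4, h5⟩
  simp only at h1 h2 h3 h4 h5
  refine ⟨(fun p : ℝ × ℝ => (p.1, p.2, (1 : ℝ))) '' {p : ℝ × ℝ | 2 ≤ p.2 ∧ p.2 ≤ p.1} ∪
    (fun t : ℝ => (k, l, t)) '' Set.Icc 1 m, ?_, ?_, ?_, ?_⟩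
  · rintro x (⟨⟨k', l'⟩, ⟨h1', h2'⟩, rfl⟩ | ⟨t, ⟨ht1, ht2⟩, rfl⟩)
    · simp only at h1' h2'
      refine ⟨h1', h2', le_rfl, ?_, ?_⟩ <;> simp only <;> nlinarith
    · refine ⟨h1, h2, ht1, ht2.trans h4, ?_⟩
      simp only
      -- The condition reads M/m > √(k+l), and M/m = 1 + (k+l-2)/m only grows as m decreases to t.
      have hM : m * (k + l + t - 2) ≥ t * (k + l + m - 2) := by nlinarith
      have h6 : t ^ 2 * (m ^ 2 * (k + l)) < t ^ 2 * (k + l + m - 2) ^ 2 := by gcongr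
      have h7 : (t * (k + l + m - 2)) ^ 2 ≤ (m * (k + l + t - 2)) ^ 2 := by
        have : 0 ≤ t * (k + l + m - 2) := mul_nonneg (by linarith) (by linarith)
        gcongr
      refine lt_of_mul_lt_mul_left (a := m ^ 2) ?_ (by positivity)
      linear_combination h6 + h7
  · exact Or.inl ⟨(2, 2), ⟨le_rfl, le_rfl⟩, rfl⟩
  · exact Or.inr ⟨m, ⟨h3, le_rfl⟩, rfl⟩
  · refine IsPreconnected.union (k, l, 1) ⟨(k, l), ⟨h1, h2⟩, rfl⟩ ⟨1, ⟨le_rfl, h3⟩, rfl⟩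
      (hslice.isPreconnected.image _ (by fun_prop)) (isPreconnected_Icc.image _ (by fun_prop))

/-- Exchange of the first two coordinates. -/
def swapFirst (a : Fin 3 → ℝ) : Fin 3 → ℝ := ![a 1, a 0, a 2]

/-- Exchange of the last two coordinates. -/
def swapLast (a : Fin 3 → ℝ) : Fin 3 → ℝ := ![a 0, a 2, a 1]

theorem continuous_swapFirst : Continuous swapFirst := by
  refine continuous_pi fun i => ?_
  fin_cases i <;> exact continuous_apply _

theorem continuous_swapLast : Continuous swapLast := by
  refine continuous_pi fun i => ?_
  fin_cases i <;> exact continuous_apply _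

theorem swapFirst_mem {a : Fin 3 → ℝ} (h : a ∈ openHalfCube \ wallachOmega) :
    swapFirst a ∈ openHalfCube \ wallachOmega := by
  refine ⟨fun i => by fin_cases i <;> exact h.1 _, fun h0 => h.2 ?_⟩
  have h1 : a 1 + a 0 + a 2 = a 0 + a 1 + a 2 := by ring
  have h2 : a 1 * a 0 + a 1 * a 2 + a 0 * a 2 = a 0 * a 1 + a 0 * a 2 + a 1 * a 2 := by ring
  have h3 : a 1 * a 0 * a 2 = a 0 * a 1 * a 2 := by ring
  have : wallachQ (a 1) (a 0) (a 2) = wallachQ (a 0) (a 1) (a 2) := by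
    simp only [wallachQ, h1, h2, h3]
  exact this.symm.trans h0

theorem swapLast_mem {a : Fin 3 → ℝ} (h : a ∈ openHalfCube \ wallachOmega) :
    swapLast a ∈ openHalfCube \ wallachOmega := by
  refine ⟨fun i => by fin_cases i <;> exact h.1 _, fun h0 => h.2 ?_⟩
  have h1 : a 0 + a 2 + a 1 = a 0 + a 1 + a 2 := by ring
  have h2 : a 0 * a 2 + a 0 * a 1 + a 2 * a 1 = a 0 * a 1 + a 0 * a 2 + a 1 * a 2 := by ring
  have h3 : a 0 * a 2 * a 1 = a 0 * a 1 * a 2 := by ring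
  have : wallachQ (a 0) (a 2) (a 1) = wallachQ (a 0) (a 1) (a 2) := by
    simp only [wallachQ, h1, h2, h3]
  exact this.symm.trans h0

theorem wallachPoint_mem_wallachO3 {x : ℝ × ℝ × ℝ} (h : x ∈ wallachParams) :
    wallachPoint x ∈ wallachO3 := by
  have hbase : ((8 / 3, 2, 4 / 3) : ℝ × ℝ × ℝ) ∈ wallachParams := by
    simp only [wallachParams, Set.mem_ofPred_eq]
    norm_num
  -- The chamber has decreasing coordinates and the base point increasing ones, so the order must be
  -- reversed: three adjacent transpositions.
  have hbase' : swapFirst (swapLast (swapFirst (wallachPoint (8 / 3, 2, 4 / 3)))) =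
      ![1 / 6, 1 / 4, 1 / 3] := by
    ext i
    fin_cases i <;> simp [wallachPoint, swapFirst, swapLast] <;> norm_num
  -- the chamber `P` meets its mirror images in the points with two equal coordinates
  have hfirst : swapFirst (wallachPoint (2, 2, 1)) = wallachPoint (2, 2, 1) := by
    ext i; fin_cases i <;> rfl
  have hlast : swapLast (wallachPoint (3, 2, 2)) = wallachPoint (3, 2, 2) := by
    ext i; fin_cases i <;> rfl
  have hmem1 : ((2, 2, 1) : ℝ × ℝ × ℝ) ∈ wallachParams := by
    simp only [wallachParams, Set.mem_ofPred_eq]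
    norm_num
  have hmem2 : ((3, 2, 2) : ℝ × ℝ × ℝ) ∈ wallachParams := by
    simp only [wallachParams, Set.mem_ofPred_eq]
    norm_num
  obtain ⟨P, hP⟩ : ∃ P, P = wallachPoint '' wallachParams := ⟨_, rfl⟩
  have hPX : ∀ a ∈ P, a ∈ openHalfCube \ wallachOmega := by
    rw [hP]
    rintro _ ⟨y, hy, rfl⟩
    exact wallachPoint_mem hy
  have hPc : IsPreconnected P :=
    hP ▸ isPreconnected_wallachParams.image _ continuousOn_wallachPoint
  have hmemP : ∀ {y}, y ∈ wallachParams → wallachPoint y ∈ P := fun hy =>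
    hP ▸ Set.mem_image_of_mem _ hy
  obtain ⟨U, hU⟩ : ∃ U, U = P ∪ swapFirst '' P := ⟨_, rfl⟩
  have hUc : IsPreconnected U := hU ▸ IsPreconnected.union _ (hmemP hmem1)
    ⟨_, hmemP hmem1, hfirst⟩ hPc (hPc.image _ continuous_swapFirst.continuousOn)
  have hUX : ∀ a ∈ U, a ∈ openHalfCube \ wallachOmega := by
    rw [hU]
    rintro _ (ha | ⟨a, ha, rfl⟩)
    exacts [hPX _ ha, swapFirst_mem (hPX _ ha)]
  have hVc : IsPreconnected (U ∪ (fun a => swapFirst (swapLast a)) '' U) := by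
    refine IsPreconnected.union (swapFirst (wallachPoint (3, 2, 2))) ?_ ?_ hUc
      (hUc.image _ (continuous_swapFirst.comp continuous_swapLast).continuousOn)
    · exact hU ▸ Or.inr ⟨_, hmemP hmem2, rfl⟩
    · exact ⟨wallachPoint (3, 2, 2), hU ▸ Or.inl (hmemP hmem2), by simp only [hlast]⟩
  refine hVc.subset_connectedComponentIn (x := ![1 / 6, 1 / 4, 1 / 3]) ?_ ?_ ?_
  · exact Or.inr ⟨_, hU ▸ Or.inr ⟨_, hmemP hbase, rfl⟩, hbase'⟩
  · rintro _ (ha | ⟨a, ha, rfl⟩)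
    exacts [hUX _ ha, swapFirst_mem (swapLast_mem (hUX _ ha))]
  · exact Or.inl (hU ▸ Or.inl (hmemP h))

theorem mainTheorem5 (k l m : ℕ) (hkl : l ≤ k) (hlm : m ≤ l) (hm : 1 ≤ m) (hl : 2 ≤ l) :
    ((m : ℝ) < (1 + Real.sqrt ((k : ℝ) + l)) * (((k : ℝ) + l - 2) / ((k : ℝ) + l - 1)) →
        soPoint k l m ∈ wallachO3) ∧
      ((m : ℝ) < Real.sqrt ((k : ℝ) + l) → soPoint k l m ∈ wallachO3) ∧
      (m = 1 → soPoint k l m ∈ wallachO3) ∧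
      (m = 2 → 5 ≤ k + l → soPoint k l m ∈ wallachO3) ∧
      (m = 3 → 7 ≤ k + l → soPoint k l m ∈ wallachO3) := by
  have hkl' : (l : ℝ) ≤ k := by exact_mod_cast hkl
  have hlm' : (m : ℝ) ≤ l := by exact_mod_cast hlm
  have hm' : (1 : ℝ) ≤ m := by exact_mod_cast hm
  have hl' : (2 : ℝ) ≤ l := by exact_mod_cast hl
  have key : (m : ℝ) ^ 2 * ((k : ℝ) + l) < ((k : ℝ) + l + m - 2) ^ 2 →
      soPoint k l m ∈ wallachO3 := fun h =>
    wallachPoint_mem_wallachO3 (x := ((k : ℝ), (l : ℝ), (m : ℝ))) ⟨hl', hkl', hm', hlm', h⟩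
  have hone : m = 1 → soPoint k l m ∈ wallachO3 := by
    rintro rfl
    refine key ?_
    push_cast
    nlinarith
  refine ⟨fun h => key ?_, fun h => ?_, hone, ?_, ?_⟩
  · have hsq : √((k : ℝ) + l) ^ 2 = (k : ℝ) + l := Real.sq_sqrt (by linarith)
    have hpos : 2 ≤ √((k : ℝ) + l) := Real.le_sqrt_of_sq_le (by linarith)
    generalize √((k : ℝ) + l) = s at h hsq hpos
    rw [← hsq] at h ⊢
    rw [← mul_div_assoc, lt_div_iff₀ (by nlinarith)] at h
    -- Here k+l-1 = (s-1)(s+1), so the factor 1+s cancels and leaves ms < s²+m-2 = M.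
    have h' : m * (s - 1) < s ^ 2 - 2 :=
      lt_of_mul_lt_mul_left (a := 1 + s) (by linear_combination h) (by linarith)
    rw [← mul_pow]
    have : 0 ≤ (m : ℝ) * s := by positivity
    exact pow_lt_pow_left₀ (by linarith) this two_ne_zero
  · rcases hm.eq_or_lt with h1 | h1
    · exact hone h1.symm
    -- Integrality gives m ≥ 2, hence k+l ≤ M and m²(k+l) < (k+l)² ≤ M².
    · have h2 : (2 : ℝ) ≤ m := by exact_mod_cast h1
      have h3 : (m : ℝ) ^ 2 < (k : ℝ) + l := (Real.lt_sqrt (by linarith)).1 h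
      refine key ?_
      have h4 : (m : ℝ) ^ 2 * ((k : ℝ) + l) < ((k : ℝ) + l) * ((k : ℝ) + l) :=
        mul_lt_mul_of_pos_right h3 (by linarith)
      nlinarith
  · rintro rfl h
    have h' : (5 : ℝ) ≤ (k : ℝ) + l := by exact_mod_cast h
    refine key ?_
    push_cast
    nlinarith
  · rintro rfl h
    have h' : (7 : ℝ) ≤ (k : ℝ) + l := by exact_mod_cast h
    refine key ?_
    push_cast
    nlinarith
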